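/- Let $p$ be a prime and let $G$ be a countably based pro-$p$ group with an infinite abelian closed normal subgroup $Z$ such that $G/C_G(Z)$ is procyclic. Let $\mathcal{S}\colon G=S_0\ge S_1\ge S_2\ge\dots$ be a filtration series of $G$, i.e. a descending chain of open normal subgroups of $G$ with $\bigcap_i S_i=1$. It induces the translation-invariant metric $d(x,y)=\inf\{|G:S_i|^{-1} : x^{-1}y\in S_i\}$ on $G$; for $U\subseteq G$ let $\mathrm{hdim}_G^{\mathcal{S}}(U)\in[0,1]$ be the Hausdorff dimension of $U$ with respect to this metric, and let $$\mathrm{hspec}_{\trianglelefteq}^{\mathcal{S}}(G)=\{\mathrm{hdim}_G^{\mathcal{S}}(H) : H \text{ a closed normal subgroup of } G\}$$ be the normal Hausdorff spectrum of $G$. For $i\ge 0$ let $p^{e_i}$ be the exponent of the finite group $Z/(S_i\cap Z)$. Suppose that, for every $i\ge 0$, there are a positive integer $n_i$ and a closed subgroup $M_i$ of $G$ such that $$\gamma_{n_i+1}(G)\cap Z\le S_i\cap Z\le M_i \qquad\text{and}\qquad \liminf_{i\to\infty}\frac{e_i n_i}{\log_p|Z:M_i\cap Z|}=0,$$ where $\gamma_m(G)$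 is the $m$-th term of the lower central series of $G$ as an abstract group (so the hypothesis holds in particular if it holds with the closures of these terms), and a quotient with positive numerator and denominator $0$ is read as $+\infty$. Suppose that $Z$ has strong Hausdorff dimension $\xi$, i.e. $\xi=\mathrm{hdim}_G^{\mathcal{S}}(Z)$ and $$\xi=\lim_{i\to\infty}\frac{\log_p|ZS_i:S_i|}{\log_p|G:S_i|}.$$ Then $[0,\xi]\subseteq\mathrm{hspec}_{\trianglelefteq}^{\mathcal{S}}(G)$. -/

import Mathlib

open Filter
open scoped ENNReal Topology

/-- A profinite (i.e. compact, Hausdorff, totally disconnected) topological group is *pro-`p`* if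
each of its quotients by an open normal subgroup (a finite group, by compactness) is a `p`-group. -/
def IsProP (p : ℕ) (G : Type*) [Group G] [TopologicalSpace G] [IsTopologicalGroup G]
    [CompactSpace G] [T2Space G] [TotallyDisconnectedSpace G] : Prop :=
  ∀ U : OpenNormalSubgroup G, IsPGroup p (G ⧸ U.toSubgroup)

/-- A profinite group is *procyclic* if it is topologically generated by one element, i.e. some
element generates a dense subgroup. -/
def IsProcyclic (G : Type*) [Group G] [TopologicalSpace G] : Prop :=
  ∃ x : G, Dense (Subgroup.zpowers x : Set G)

/-- A *filtration series* of `G`: a descending chain `G = S 0 ≥ S 1 ≥ S 2 ≥ ...` of open normal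
subgroups with trivial intersection. -/
structure FiltrationSeries (G : Type*) [Group G] [TopologicalSpace G] where
  term : ℕ → OpenNormalSubgroup G
  term_zero : (term 0).toSubgroup = ⊤
  antitone : ∀ i j : ℕ, i ≤ j → (term j).toSubgroup ≤ (term i).toSubgroup
  iInf_eq_bot : ⨅ i, (term i).toSubgroup = ⊥

namespace FiltrationSeries

variable {G : Type*} [Group G] [TopologicalSpace G]

/-- The `i`-th subgroup of a filtration series. -/
def sub (S : FiltrationSeries G) (i : ℕ) : Subgroup G := (S.term i).toSubgroup

instance (S : FiltrationSeries G) (i : ℕ) : (S.sub i).Normal :=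
  inferInstanceAs (S.term i).toSubgroup.Normal

open scoped Classical in
/-- The distance `inf {|G : S i|⁻¹ | x⁻¹ y ∈ S i}` of `x` and `y`. (For `x = y` the infimum is `0`
as soon as `G` is infinite; the case distinction only matters for finite `G`.) -/
noncomputable def dist (S : FiltrationSeries G) (x y : G) : ℝ≥0∞ :=
  if x = y then 0 else ⨅ (i : ℕ) (_ : x⁻¹ * y ∈ S.sub i), ((S.sub i).index : ℝ≥0∞)⁻¹

theorem index_ne_zero [IsTopologicalGroup G] [CompactSpace G] (S : FiltrationSeries G) (i : ℕ) :
    (S.sub i).index ≠ 0 := by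
  have : Finite (G ⧸ S.sub i) :=
    Subgroup.quotient_finite_of_isOpen _ (S.term i).toOpenSubgroup.isOpen
  exact Subgroup.index_ne_zero_of_finite

theorem inv_index_antitone [IsTopologicalGroup G] [CompactSpace G] (S : FiltrationSeries G)
    {i j : ℕ} (h : i ≤ j) : ((S.sub j).index : ℝ≥0∞)⁻¹ ≤ ((S.sub i).index : ℝ≥0∞)⁻¹ := by
  rw [ENNReal.inv_le_inv]
  exact_mod_cast Nat.le_of_dvd (Nat.pos_of_ne_zero (S.index_ne_zero j))
    (Subgroup.index_dvd_of_le (S.antitone i j h))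

theorem dist_comm (S : FiltrationSeries G) (x y : G) : S.dist x y = S.dist y x := by
  have h : ∀ i, x⁻¹ * y ∈ S.sub i ↔ y⁻¹ * x ∈ S.sub i := fun i => by
    rw [← inv_mem_iff]; simp
  by_cases hxy : x = y
  · rw [hxy]
  · simp only [dist, h, if_neg hxy, if_neg (Ne.symm hxy)]

theorem dist_triangle_max [IsTopologicalGroup G] [CompactSpace G] (S : FiltrationSeries G)
    (x y z : G) : S.dist x z ≤ max (S.dist x y) (S.dist y z) := by
  by_cases hxy : x = y
  · subst hxy; exact le_max_right _ _
  by_cases hyz : y = z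
  · subst hyz; exact le_max_left _ _
  by_cases hxz : x = z
  · simp [dist, hxz]
  rw [← not_lt]
  intro hlt
  rw [max_lt_iff] at hlt
  obtain ⟨h1, h2⟩ := hlt
  rw [dist, if_neg hxy] at h1
  rw [dist, if_neg hyz] at h2
  simp only [iInf_lt_iff] at h1 h2
  obtain ⟨i, hi, hi'⟩ := h1
  obtain ⟨j, hj, hj'⟩ := h2
  have key : ∀ k, k ≤ i → k ≤ j → S.dist x z ≤ ((S.sub k).index : ℝ≥0∞)⁻¹ := by
    intro k hki hkj
    rw [dist, if_neg hxz]
    refine iInf₂_le k ?_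
    have h' : (x⁻¹ * y) * (y⁻¹ * z) ∈ S.sub k :=
      mul_mem (S.antitone k i hki hi) (S.antitone k j hkj hj)
    simpa [mul_assoc] using h'
  rcases le_total i j with h | h
  · exact absurd hi' (not_lt.2 (key i le_rfl h))
  · exact absurd hj' (not_lt.2 (key j h le_rfl))

theorem eq_of_dist_eq_zero [IsTopologicalGroup G] [CompactSpace G] (S : FiltrationSeries G)
    {x y : G} (h : S.dist x y = 0) : x = y := by
  by_contra hxy
  have hne : x⁻¹ * y ≠ 1 := fun h' => hxy (inv_mul_eq_one.1 h')
  have : ∃ k, x⁻¹ * y ∉ S.sub k := by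
    by_contra! hall
    have hm : x⁻¹ * y ∈ ⨅ i, (S.term i).toSubgroup := Subgroup.mem_iInf.2 hall
    rw [S.iInf_eq_bot, Subgroup.mem_bot] at hm
    exact hne hm
  obtain ⟨k, hk⟩ := this
  have hle : ((S.sub k).index : ℝ≥0∞)⁻¹ ≤ S.dist x y := by
    rw [dist, if_neg hxy]
    refine le_iInf₂ fun i hi => S.inv_index_antitone ?_
    by_contra! hki
    exact hk (S.antitone k i hki.le hi)
  rw [h] at hle
  simp at hle

/-- The translation-invariant metric on `G` defined by a filtration series. -/
noncomputable abbrev emetricSpace [IsTopologicalGroup G] [CompactSpace G]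
    (S : FiltrationSeries G) : EMetricSpace G where
  edist := S.dist
  edist_self x := by simp [dist]
  edist_comm := S.dist_comm
  edist_triangle x y z := (S.dist_triangle_max x y z).trans (max_le_add_of_nonneg zero_le zero_le)
  eq_of_edist_eq_zero h := S.eq_of_dist_eq_zero h

/-- The Hausdorff dimension of a subset of `G` with respect to the metric defined by `S`. -/
noncomputable def hdim [IsTopologicalGroup G] [CompactSpace G]
    (S : FiltrationSeries G) (U : Set G) : ℝ≥0∞ :=
  @dimH G S.emetricSpace U

/-- The ratio `log_p |H S_i : S_i| / log_p |G : S_i|`. -/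
noncomputable def logDensity (p : ℕ) (S : FiltrationSeries G) (H : Subgroup G) (i : ℕ) : ℝ :=
  Real.logb p ((S.sub i).relIndex (H ⊔ S.sub i)) / Real.logb p ((S.sub i).index)

/-- `H` has *strong Hausdorff dimension*: its Hausdorff dimension is the limit of the ratios
`log_p |H S_i : S_i| / log_p |G : S_i|`. -/
def HasStrongHausdorffDimension [IsTopologicalGroup G] [CompactSpace G]
    (p : ℕ) (S : FiltrationSeries G) (H : Subgroup G) : Prop :=
  Tendsto (fun i => ENNReal.ofReal (logDensity p S H i)) atTop (𝓝 (S.hdim (H : Set G)))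

/-- The *normal Hausdorff spectrum*: the set of Hausdorff dimensions of closed normal subgroups. -/
def normalHausdorffSpectrum [IsTopologicalGroup G] [CompactSpace G]
    (S : FiltrationSeries G) : Set ℝ≥0∞ :=
  {d | ∃ H : Subgroup G, IsClosed (H : Set G) ∧ H.Normal ∧ S.hdim (H : Set G) = d}

end FiltrationSeries

/-! Write η = θξ with 0 < θ ≤ 1 and c_i = |Z : S_i ∩ Z|^θ. It is enough to find a closed normal
subgroup H whose index over S_i is at least c_i for every i and less than p·c_i for infinitely many
i. Covers by cosets at those i bound the dimension above by θξ; Haar measure on H and the mass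
distribution principle bound it below. The factor p is harmless, since log p / log |G : S_i| tends
to 0, and ξ is a limit, so every subsequence of the densities of Z gives ξ
(`hdim_eq_of_frequently`).

Zorn's lemma gives a minimal closed normal H ≤ Z with all indices at least c_i. If the indices were
at least p·c_i from some N on, take the closed normal closure L of finitely many representatives of
H modulo S_N. If L ≠ H, there is a closed normal K of index p in H containing L. It has the index of
H up to N and loses at most a factor p afterwards, against minimality
(`exists_isClosed_normal_frequently_relIndex_lt`).

That L ≠ H is where the commutator hypothesis enters. If x generates G modulo C_G(Z), then modulo
S_i a normal subgroup generated by a finite F ⊆ Z is generated by the commutators [x,…,[x,f]] with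
fewer than n_i entries x, so its index is at most p^(e_i n_i |F|)
(`relIndex_topologicalClosure_normalClosure_le`). As the lower limit is zero, this is below c_i for
some i. -/

open scoped commutatorElement

/-! ### Chief factors of finite p-groups -/

/-- In a finite `p`-group, below a normal subgroup `B` and above a smaller normal subgroup `A` there
is a normal subgroup of index `p` in `B`. -/
theorem IsPGroup.exists_normal_relIndex_eq {p : ℕ} (hp : p.Prime) {Q : Type*} [Group Q] [Finite Q]
    (hQ : IsPGroup p Q) {A B : Subgroup Q} [A.Normal] [B.Normal] (hAB : A < B) :
    ∃ K : Subgroup Q, K.Normal ∧ A ≤ K ∧ K ≤ B ∧ K.relIndex B = p := by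
  have : Fact p.Prime := ⟨hp⟩
  -- A maximal normal K with A ≤ K < B works: B/K meets the centre of Q/K, and the preimage of a
  -- central subgroup of order p inside B/K must be all of B.
  obtain ⟨K, ⟨hKn, hAK, hKB⟩, hmax⟩ :=
    (Set.toFinite {K : Subgroup Q | K.Normal ∧ A ≤ K ∧ K < B}).exists_maximal
      ⟨A, inferInstance, le_rfl, hAB⟩
  refine ⟨K, hKn, hAK, hKB.le, ?_⟩
  let π := QuotientGroup.mk' K
  have hπ : Function.Surjective π := QuotientGroup.mk'_surjective K
  have hker : π.ker = K := QuotientGroup.ker_mk' K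
  have hBn : (B.map π).Normal := Subgroup.Normal.map inferInstance _ hπ
  have hBne : B.map π ≠ ⊥ := by
    rw [Ne, Subgroup.map_eq_bot_iff, hker]
    exact hKB.not_ge
  have hQK : IsPGroup p (Q ⧸ K) := hQ.to_quotient K
  -- The number of fixed points of conjugation on B/K is divisible by p, so 1 is not the only one.
  obtain ⟨b, hb, hbne⟩ : ∃ b ∈ MulAction.fixedPoints (ConjAct (Q ⧸ K)) (B.map π), 1 ≠ b := by
    refine (IsPGroup.exists_fixed_point_of_prime_dvd_card_of_fixed_point
      (p := p) (G := ConjAct (Q ⧸ K)) ?_ (B.map π) ?_ (a := 1) ?_)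
    · exact hQK.of_equiv ConjAct.toConjAct
    · have hnt : Nontrivial (B.map π) := (Subgroup.nontrivial_iff_ne_bot _).2 hBne
      obtain ⟨n, hn0, hn⟩ := (hQK.to_subgroup (B.map π)).nontrivial_iff_card.1 hnt
      rw [hn]
      exact dvd_pow_self p hn0.ne'
    · intro g
      exact smul_one g
  have hbc : (b : Q ⧸ K) ∈ Subgroup.center (Q ⧸ K) := by
    rw [Subgroup.mem_center_iff]
    intro g
    have h := congrArg (Subtype.val) (hb (ConjAct.toConjAct g))
    rw [ConjAct.Subgroup.val_conj_smul, ConjAct.smul_def, ConjAct.ofConjAct_toConjAct] at h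
    exact mul_inv_eq_iff_eq_mul.1 h
  have hne : B.map π ⊓ Subgroup.center (Q ⧸ K) ≠ ⊥ := by
    intro h
    have : (b : Q ⧸ K) ∈ (⊥ : Subgroup (Q ⧸ K)) := h ▸ ⟨b.2, hbc⟩
    exact hbne (Subtype.ext (Subgroup.mem_bot.1 this).symm)
  have hdvd : p ∣ Nat.card (B.map π ⊓ Subgroup.center (Q ⧸ K) : Subgroup (Q ⧸ K)) := by
    obtain ⟨n, hn0, hn⟩ := (hQK.to_subgroup _).nontrivial_iff_card.1
      ((Subgroup.nontrivial_iff_ne_bot _).2 hne)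
    rw [hn]
    exact dvd_pow_self p hn0.ne'
  obtain ⟨⟨z, hzB, hzc⟩, hz⟩ := exists_prime_orderOf_dvd_card' p hdvd
  replace hz : orderOf z = p := (Subgroup.orderOf_coe _).trans hz
  have hzn : (Subgroup.zpowers z).Normal :=
    ⟨fun y hy g => by
      have hyc : y ∈ Subgroup.center (Q ⧸ K) := (Subgroup.zpowers_le.2 hzc) hy
      rwa [Subgroup.mem_center_iff.1 hyc g, mul_inv_cancel_right]⟩
  have hCB : (Subgroup.zpowers z).comap π ≤ B := by
    calc (Subgroup.zpowers z).comap π ≤ (B.map π).comap π :=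
          Subgroup.comap_mono (Subgroup.zpowers_le.2 hzB)
      _ = B := by rw [Subgroup.comap_map_eq, hker, sup_eq_left.2 hKB.le]
  have hKC : K ≤ (Subgroup.zpowers z).comap π := by
    exact hker.ge.trans (Subgroup.ker_le_comap _ _)
  have hCeq : (Subgroup.zpowers z).comap π = B := by
    by_contra hne
    have h1 := hmax ⟨hzn.comap π, hAK.trans hKC, lt_of_le_of_ne hCB hne⟩ hKC
    obtain ⟨y, hy⟩ := hπ z
    have hyK : y ∈ K := h1 (by simp [Subgroup.mem_comap, hy])
    rw [← hker, MonoidHom.mem_ker, hy] at hyK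
    rw [hyK, orderOf_one] at hz
    exact hp.one_lt.ne hz
  have hrel : K.relIndex B = π.ker.relIndex ((Subgroup.zpowers z).comap π) := by
    rw [hCeq, hker]
  rw [hrel, Subgroup.relIndex_ker, Subgroup.map_comap_eq_self_of_surjective hπ, Nat.card_zpowers, hz]

/-! ### Closed normal subgroups of compact groups -/

section Compact

variable {G : Type*} [Group G] [TopologicalSpace G] [IsTopologicalGroup G] [CompactSpace G]

theorem Subgroup.index_ne_zero_of_isOpen {U : Subgroup G} (hU : IsOpen (U : Set G)) :
    U.index ≠ 0 := by
  have : Finite (G ⧸ U) := Subgroup.quotient_finite_of_isOpen U hU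
  exact Subgroup.index_ne_zero_of_finite

theorem Subgroup.relIndex_ne_zero_of_isOpen {U : Subgroup G} (hU : IsOpen (U : Set G))
    (H : Subgroup G) : U.relIndex H ≠ 0 := fun h =>
  Subgroup.index_ne_zero_of_isOpen hU
    (by rw [← Subgroup.relIndex_top_right]; exact Subgroup.relIndex_eq_zero_of_le_right le_top h)

/-- A chain of closed subgroups is eventually constant modulo an open subgroup. -/
theorem IsChain.exists_le_sInf_sup {C : Set (Subgroup G)} (hC : IsChain (· ≤ ·) C)
    (hne : C.Nonempty) (hcl : ∀ H ∈ C, IsClosed (H : Set G)) {U : Subgroup G}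
    (hU : IsOpen (U : Set G)) : ∃ H ∈ C, H ≤ sInf C ⊔ U := by
  by_contra! hno
  have : Nonempty C := hne.to_subtype
  have hop : IsOpen ((sInf C ⊔ U : Subgroup G) : Set G) := Subgroup.isOpen_mono le_sup_right hU
  have hcl' : ∀ H : C, IsClosed ((H : Subgroup G) \ (sInf C ⊔ U : Subgroup G) : Set G) := fun H =>
    (hcl H H.2).sdiff hop
  -- By compactness the nonempty sets H \ (⋂C)U have a common point, which would lie in ⋂C.
  obtain ⟨y, hy⟩ := IsCompact.nonempty_iInter_of_directed_nonempty_isCompact_isClosed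
    (fun H : C => ((H : Subgroup G) \ (sInf C ⊔ U : Subgroup G) : Set G))
    (fun H K => by
      rcases hC.total H.2 K.2 with h | h
      · exact ⟨H, subset_rfl, Set.sdiff_subset_sdiff_left h⟩
      · exact ⟨K, Set.sdiff_subset_sdiff_left h, subset_rfl⟩)
    (fun H => Set.sdiff_nonempty.2 (hno H H.2))
    (fun H => (hcl' H).isCompact) hcl'
  rw [Set.mem_iInter] at hy
  obtain ⟨H⟩ := this
  exact (hy H).2 (Subgroup.mem_sup_left (Subgroup.mem_sInf.2 fun K hK => (hy ⟨K, hK⟩).1))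

/-- Among the closed normal subgroups of `Z` whose indices over the open normal subgroups `U i`
are bounded below by `c i`, there is a minimal one. -/
theorem exists_minimal_isClosed_normal_le_relIndex {ι : Type*} (U : ι → Subgroup G)
    [∀ i, (U i).Normal] (hU : ∀ i, IsOpen (U i : Set G)) (c : ι → ℝ) (Z : Subgroup G) [Z.Normal]
    (hZ : IsClosed (Z : Set G)) (hcZ : ∀ i, c i ≤ (U i).relIndex Z) :
    ∃ H : Subgroup G, Minimal (fun H : Subgroup G =>
      IsClosed (H : Set G) ∧ H.Normal ∧ H ≤ Z ∧ ∀ i, c i ≤ (U i).relIndex H) H := by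
  let P : Set (Subgroup G)ᵒᵈ :=
    {H | IsClosed ((OrderDual.ofDual H : Subgroup G) : Set G) ∧ (OrderDual.ofDual H).Normal ∧
      OrderDual.ofDual H ≤ Z ∧ ∀ i, c i ≤ (U i).relIndex (OrderDual.ofDual H)}
  have hP : ∀ C ⊆ P, IsChain (· ≤ ·) C → ∀ Y ∈ C, ∃ ub ∈ P, ∀ K ∈ C, K ≤ ub := by
    intro C hCs hC Y hY
    let C' : Set (Subgroup G) := C
    have hC' : IsChain (· ≤ ·) C' := hC.symm
    have hlb : ∀ K ∈ C', sInf C' ≤ K := fun K hK => sInf_le hK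
    refine ⟨OrderDual.toDual (sInf C'), ⟨?_, ?_, ?_, fun i => ?_⟩, hlb⟩
    · simp only [OrderDual.ofDual_toDual, Subgroup.coe_sInf]
      exact isClosed_biInter fun K hK => (hCs hK).1
    · refine ⟨fun a ha g => Subgroup.mem_sInf.2 fun K hK => ?_⟩
      exact (hCs hK).2.1.conj_mem a (Subgroup.mem_sInf.1 ha K hK) g
    · exact (sInf_le (a := Y) (s := C') hY).trans (hCs hY).2.2.1
    -- Modulo `U i` the intersection of the chain agrees with one of its members, so it inherits the
    -- bound.
    · obtain ⟨K, hK, hle⟩ := hC'.exists_le_sInf_sup ⟨Y, hY⟩ (fun K hK => (hCs hK).1) (hU i)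
      refine ((hCs hK).2.2.2 i).trans ?_
      rw [OrderDual.ofDual_toDual, ← Subgroup.relIndex_sup_right (sInf C') (U i)]
      exact_mod_cast Subgroup.relIndex_le_of_le_right hle
        (Subgroup.relIndex_ne_zero_of_isOpen (hU i) _)
  obtain ⟨H, -, hH⟩ := zorn_le_nonempty₀ P hP (OrderDual.toDual Z) ⟨hZ, ‹Z.Normal›, le_rfl, hcZ⟩
  exact ⟨OrderDual.ofDual H, hH.1, fun K hK hKH => hH.2 hK hKH⟩

/-- If `mk x` topologically generates `G ⧸ C`, then every element of `G` is the product of a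
natural power of `x`, an element of `C` and an element of the open normal subgroup `U`. -/
theorem exists_eq_pow_mul_mul {C U : Subgroup G} [C.Normal] [U.Normal] (hU : IsOpen (U : Set G))
    {x : G} (hx : Dense (Subgroup.zpowers (x : G ⧸ C) : Set (G ⧸ C))) (g : G) :
    ∃ k : ℕ, ∃ c ∈ C, ∃ u ∈ U, g = x ^ k * c * u := by
  have hop : IsOpen ((QuotientGroup.mk : G → G ⧸ C) '' ((fun y => g * y) '' (U : Set G))) :=
    QuotientGroup.isOpenMap_coe _ (isOpenMap_mul_left g _ hU)
  obtain ⟨_, ⟨k, hk⟩, ⟨_, ⟨u, hu, rfl⟩, hy⟩⟩ :=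
    hx.exists_mem_open hop ⟨_, _, ⟨1, U.one_mem, rfl⟩, rfl⟩
  have hc : (x ^ k)⁻¹ * (g * u) ∈ C := by
    rw [← QuotientGroup.eq]
    rw [hy, ← hk]
    simp
  have hm0 : U.index ≠ 0 := Subgroup.index_ne_zero_of_isOpen hU
  have hxU : x ^ U.index ∈ U := Subgroup.pow_index_mem U x
  set m := U.index
  set c := (x ^ k)⁻¹ * (g * u)
  have hr : 0 ≤ k % m := Int.emod_nonneg _ (by exact_mod_cast hm0)
  -- Reducing k modulo m = |G : U| makes the exponent natural, as is needed when only xAx⁻¹ ≤ A is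
  -- known. The surplus power of x^m lies in U and moves past c by normality.
  refine ⟨(k % m).toNat, c, hc, c⁻¹ * (x ^ m) ^ (k / m) * c * u⁻¹,
    mul_mem ?_ (inv_mem hu), ?_⟩
  · simpa using Subgroup.Normal.conj_mem inferInstance _ (U.zpow_mem hxU (k / m)) c⁻¹
  · have hkm : x ^ (k % m).toNat * (x ^ m) ^ (k / m) = x ^ k := by
      rw [← zpow_natCast, Int.toNat_of_nonneg hr, ← zpow_natCast x m, ← zpow_mul, ← zpow_add,
        Int.emod_add_mul_ediv]
    have : g = x ^ k * c * u⁻¹ := by simp [c, mul_assoc]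
    rw [this, ← hkm]
    group

/-- A subgroup `A` of `Z` containing `U ⊓ Z` and stable under conjugation by an element generating
`G` topologically modulo the centralizer of `Z` is normal. -/
theorem Subgroup.normal_of_conj_mem {Z U A : Subgroup G} [Z.Normal] [U.Normal]
    (hU : IsOpen (U : Set G)) {x : G}
    (hx : Dense (Subgroup.zpowers (x : G ⧸ centralizer (Z : Set G)) :
      Set (G ⧸ centralizer (Z : Set G))))
    (hAZ : A ≤ Z) (hUA : U ⊓ Z ≤ A) (hxA : ∀ a ∈ A, x * a * x⁻¹ ∈ A) : A.Normal := by
  refine ⟨fun a ha g => ?_⟩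
  obtain ⟨k, c, hc, u, hu, rfl⟩ := exists_eq_pow_mul_mul hU hx g
  have h1 : u * a * u⁻¹ ∈ A := by
    -- A commutator of elements of the normal subgroups U and Z lies in both.
    have : u * a * u⁻¹ * a⁻¹ ∈ U ⊓ Z := by
      refine ⟨?_, ?_⟩
      · simpa [mul_assoc] using U.mul_mem hu
          (Subgroup.Normal.conj_mem inferInstance _ (U.inv_mem hu) a)
      · exact Z.mul_mem (Subgroup.Normal.conj_mem inferInstance _ (hAZ ha) u)
          (Z.inv_mem (hAZ ha))
    simpa using A.mul_mem (hUA this) ha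
  have h2 : c * (u * a * u⁻¹) * c⁻¹ = u * a * u⁻¹ := by
    rw [← Subgroup.mem_centralizer_iff.1 hc _ (hAZ h1), mul_inv_cancel_right]
  have h3 : ∀ (k : ℕ), ∀ a ∈ A, x ^ k * a * (x ^ k)⁻¹ ∈ A := by
    intro k
    induction k with
    | zero => intro a ha; simpa using ha
    | succ k ih =>
      intro a ha
      have := ih _ (hxA a ha)
      rwa [show x ^ k * (x * a * x⁻¹) * (x ^ k)⁻¹ = x ^ (k + 1) * a * (x ^ (k + 1))⁻¹ by
        rw [pow_succ]; group] at this
  have := h3 k _ h1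
  rw [← h2] at this
  convert this using 1
  group

/-! ### Normal closures of finite subsets of Z -/

theorem iterate_commutatorElement_mem_lowerCentralSeries {G : Type*} [Group G] (x f : G) (k : ℕ) :
    (fun z => ⁅x, z⁆)^[k] f ∈ (⊤ : Subgroup G).lowerCentralSeries k := by
  induction k with
  | zero => exact Subgroup.mem_top _
  | succ k ih =>
    rw [Function.iterate_succ_apply', Subgroup.lowerCentralSeries_succ, ← commutatorElement_inv]
    exact inv_mem (Subgroup.commutator_mem_commutator ih (Subgroup.mem_top x))

theorem iterate_commutatorElement_mem_of_mem {G : Type*} [Group G] {Z : Subgroup G} [Z.Normal]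
    (x : G) {f : G} (hf : f ∈ Z) (k : ℕ) : (fun z => ⁅x, z⁆)^[k] f ∈ Z := by
  induction k with
  | zero => exact hf
  | succ k ih =>
    rw [Function.iterate_succ_apply']
    exact Z.mul_mem (Subgroup.Normal.conj_mem inferInstance _ ih x) (Z.inv_mem ih)

/-- The order of an abelian subgroup generated by a finite set, of exponent dividing `m`. -/
theorem Subgroup.card_closure_dvd_pow {Q : Type*} [Group Q] {Y : Subgroup Q} [IsMulCommutative Y]
    (T : Finset Q) (hT : (T : Set Q) ⊆ Y) {m : ℕ} (hm : ∀ y ∈ Y, y ^ m = 1) :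
    Nat.card (Subgroup.closure (T : Set Q)) ∣ m ^ T.card := by
  have hle : closure (T : Set Q) ≤ Y := (closure_le Y).2 hT
  let I : CommGroup (closure (T : Set Q)) :=
    { (inferInstance : Group (closure (T : Set Q))) with
      mul_comm := fun a b => Subtype.ext (by
        have h : (⟨a, hle a.2⟩ : Y) * ⟨b, hle b.2⟩ = ⟨b, hle b.2⟩ * ⟨a, hle a.2⟩ :=
          IsMulCommutative.is_comm.comm _ _
        have h' := congrArg Subtype.val h
        exact h') }
  have h := @card_dvd_exponent_pow_rank' (closure (T : Set Q)) I inferInstance m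
    (fun g => Subtype.ext (hm g (hle g.2)))
  exact h.trans (pow_dvd_pow m (rank_closure_finset_le_card T))

/-- A bound for the index of the closed normal closure of a finite subset of `Z` over `U`. -/
theorem relIndex_topologicalClosure_normalClosure_le {Z U : Subgroup G} [Z.Normal]
    [IsMulCommutative Z] [U.Normal] (hU : IsOpen (U : Set G))
    (hproc : IsProcyclic (G ⧸ Subgroup.centralizer (Z : Set G))) {m n : ℕ} (hm0 : 0 < m)
    (hm : ∀ z ∈ Z, z ^ m ∈ U) (hγ : (⊤ : Subgroup G).lowerCentralSeries n ⊓ Z ≤ U ⊓ Z)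
    (hn : 0 < n) (F : Finset G) (hF : (F : Set G) ⊆ Z) :
    U.relIndex (Subgroup.normalClosure (F : Set G)).topologicalClosure ≤ m ^ (n * F.card) := by
  classical
  obtain ⟨x, hx⟩ := hproc
  obtain ⟨x, rfl⟩ := QuotientGroup.mk_surjective x
  let T : Finset G := (Finset.range n ×ˢ F).image fun q => (fun z => ⁅x, z⁆)^[q.1] q.2
  have hTZ : (T : Set G) ⊆ Z := by
    intro t ht
    simp only [T, Finset.coe_image, Set.mem_image, Finset.mem_coe, Finset.mem_product] at ht
    obtain ⟨q, hq, rfl⟩ := ht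
    exact iterate_commutatorElement_mem_of_mem x (hF hq.2) _
  have hTcard : T.card ≤ n * F.card := Finset.card_image_le.trans (by simp)
  -- A is stable under conjugation by x because xtx⁻¹ = [x,t]t, and the commutator of length n falls
  -- into γ_{n+1}(G) ∩ Z ≤ U.
  let A : Subgroup G := (U ⊓ Z) ⊔ Subgroup.closure (T : Set G)
  have hAZ : A ≤ Z := sup_le inf_le_right ((Subgroup.closure_le Z).2 hTZ)
  have hTA : ∀ t ∈ T, t ∈ A := fun t ht => Subgroup.mem_sup_right (Subgroup.subset_closure ht)
  have hxA : A ≤ A.comap (MulAut.conj x).toMonoidHom := by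
    refine sup_le ?_ ((Subgroup.closure_le _).2 ?_)
    · intro w hw
      exact Subgroup.mem_sup_left (Subgroup.Normal.conj_mem inferInstance w hw x)
    · intro t ht
      have htA := hTA t ht
      simp only [T, Finset.coe_image, Set.mem_image, Finset.mem_coe, Finset.mem_product,
        Finset.mem_range] at ht
      obtain ⟨⟨k, f⟩, ⟨hk, hf⟩, rfl⟩ := ht
      set t := (fun z => ⁅x, z⁆)^[k] f with ht
      have hδ : ⁅x, t⁆ ∈ A := by
        have e : ⁅x, t⁆ = (fun z => ⁅x, z⁆)^[k + 1] f := by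
          rw [Function.iterate_succ_apply']
        rw [e]
        rcases Nat.lt_or_ge (k + 1) n with h | h
        · exact hTA _ (Finset.mem_image.2 ⟨(k + 1, f), by simp [h, hf], rfl⟩)
        · have hkn : k + 1 = n := by have : k < n := hk; omega
          refine Subgroup.mem_sup_left (hγ ⟨?_, iterate_commutatorElement_mem_of_mem x (hF hf) _⟩)
          rw [hkn]
          exact iterate_commutatorElement_mem_lowerCentralSeries x f n
      have := A.mul_mem hδ htA
      simpa [commutatorElement_def] using this
  have hAn : A.Normal := Subgroup.normal_of_conj_mem hU hx hAZ le_sup_left fun a ha => hxA ha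
  have hle : (Subgroup.normalClosure (F : Set G)).topologicalClosure ≤ A ⊔ U := by
    refine Subgroup.topologicalClosure_minimal _ ?_
      (Subgroup.isClosed_of_isOpen _ (Subgroup.isOpen_mono le_sup_right hU))
    refine (Subgroup.normalClosure_le_normal fun f hf => ?_).trans (le_sup_left : A ≤ A ⊔ U)
    exact hTA f (Finset.mem_image.2 ⟨(0, f), by simp [hn]; exact hf, rfl⟩)
  have hAU : A ⊔ U = Subgroup.closure (T : Set G) ⊔ U := by
    refine le_antisymm (sup_le (sup_le ?_ le_sup_left) le_sup_right)
      (sup_le_sup_right le_sup_right U)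
    exact inf_le_left.trans le_sup_right
  -- The image of ⟨T⟩ in ZU/U is abelian of exponent dividing m, so its order is at most m to the
  -- number of generators.
  have hcard : U.relIndex (Subgroup.closure (T : Set G)) ∣ m ^ (T.image (QuotientGroup.mk' U)).card := by
    have hker : U.relIndex (Subgroup.closure (T : Set G)) =
        (QuotientGroup.mk' U).ker.relIndex (Subgroup.closure (T : Set G)) := by
      rw [QuotientGroup.ker_mk']
    rw [hker, Subgroup.relIndex_ker, MonoidHom.map_closure, ← Finset.coe_image]
    have : IsMulCommutative (Z.map (QuotientGroup.mk' U)) := inferInstance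
    refine (Subgroup.card_closure_dvd_pow (Y := Z.map (QuotientGroup.mk' U)) _ ?_ ?_)
    · rw [Finset.coe_image, Subgroup.coe_map]
      exact Set.image_mono hTZ
    · rintro _ ⟨z, hz, rfl⟩
      rw [← map_pow, ← MonoidHom.mem_ker, QuotientGroup.ker_mk']
      exact hm z hz
  calc U.relIndex (Subgroup.normalClosure (F : Set G)).topologicalClosure
      ≤ U.relIndex (A ⊔ U) := Subgroup.relIndex_le_of_le_right hle
        (Subgroup.relIndex_ne_zero_of_isOpen hU _)
    _ = U.relIndex (Subgroup.closure (T : Set G)) := by rw [hAU, Subgroup.relIndex_sup_right]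
    _ ≤ m ^ (T.image (QuotientGroup.mk' U)).card := Nat.le_of_dvd (by positivity) hcard
    _ ≤ m ^ (n * F.card) := Nat.pow_le_pow_right hm0 (Finset.card_image_le.trans hTcard)

end Compact

/-! ### Bounds for the Hausdorff dimension -/

open MeasureTheory Measure NNReal in
/-- An upper bound for the Hausdorff dimension from efficient covers at infinitely many scales. -/
theorem dimH_le_of_frequently_cover {X : Type*} [EMetricSpace X] {s : Set X} {d : NNReal}
    {r : ℕ → ℝ≥0∞} (hr : Tendsto r atTop (𝓝 0))
    (h : ∃ᶠ n in atTop, ∃ T : Finset (Set X), (s ⊆ ⋃ t ∈ T, t) ∧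
      (∀ t ∈ T, Metric.ediam t ≤ r n) ∧ (T.card : ℝ≥0∞) * r n ^ (d : ℝ) ≤ 1) :
    dimH s ≤ d := by
  borelize X
  obtain ⟨φ, hφ, hT⟩ := extraction_of_frequently_atTop h
  choose T hcov hdiam hcard using hT
  -- Along the good scales the covering sums are at most 1, hence so is the d-dimensional measure.
  refine dimH_le_of_hausdorffMeasure_ne_top (ne_top_of_le_ne_top ENNReal.one_ne_top ?_)
  refine (hausdorffMeasure_le_liminf_sum (ι := fun n => T n) (d : ℝ) s (fun n => r (φ n))
    (hr.comp hφ.tendsto_atTop) (fun n t => (t : Set X))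
    (Eventually.of_forall fun n t => hdiam n t t.2)
    (Eventually.of_forall fun n => (hcov n).trans ?_)).trans ?_
  · intro x hx
    simpa using hx
  · refine liminf_le_of_le (by isBoundedDefault) fun b hb => ?_
    obtain ⟨n, hn⟩ := hb.exists
    refine hn.trans (le_trans ?_ (hcard n))
    calc ∑ t : T n, Metric.ediam (t : Set X) ^ (d : ℝ)
        ≤ ∑ t : T n, r (φ n) ^ (d : ℝ) :=
          Finset.sum_le_sum fun t _ => ENNReal.rpow_le_rpow (hdiam n t t.2) d.2
      _ = (T n).card * r (φ n) ^ (d : ℝ) := by simp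

open MeasureTheory Measure in
/-- The mass distribution principle for the image of the Haar measure of a compact group. -/
theorem le_dimH_range_of_preimage_subset_coset {X : Type*} [EMetricSpace X] {K : Type*} [Group K]
    [TopologicalSpace K] [IsTopologicalGroup K] [CompactSpace K] (f : K → X)
    (hf : ∀ k, ∀ ε > 0, ∀ᶠ k' in 𝓝 k, edist (f k') (f k) < ε) (V : ℕ → Subgroup K)
    (hV : ∀ i, IsOpen (V i : Set K)) (d : NNReal) (ε : ℝ≥0∞) (hε : 0 < ε)
    (h : ∀ t : Set X, Metric.ediam t ≤ ε → ∀ δ > Metric.ediam t ^ (d : ℝ),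
      ∃ i, ∃ k : K, (∀ y, f y ∈ t → k⁻¹ * y ∈ V i) ∧ ((V i).index : ℝ≥0∞)⁻¹ ≤ δ) :
    (d : ℝ≥0∞) ≤ dimH (Set.range f) := by
  borelize X
  borelize K
  have hfc : Continuous f :=
    continuous_iff_continuousAt.2 fun k => EMetric.tendsto_nhds.2 (hf k)
  let ν : Measure K := haarMeasure ⊤
  have hν1 : ν Set.univ = 1 := haarMeasure_self
  have hVν : ∀ i, ∀ k : K, ν {y | k⁻¹ * y ∈ V i} = ((V i).index : ℝ≥0∞)⁻¹ := by
    intro i k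
    have hfin : (V i).FiniteIndex := ⟨Subgroup.index_ne_zero_of_isOpen (hV i)⟩
    have h1 := Subgroup.index_mul_measure (V i) (hV i).measurableSet ν
    rw [hν1] at h1
    have h2 : ν {y | k⁻¹ * y ∈ V i} = ν (V i) := measure_preimage_mul ν k⁻¹ (V i : Set K)
    rw [h2]
    exact ENNReal.eq_inv_of_mul_eq_one_left (by rw [mul_comm]; exact h1)
  have hle : ν.map f ≤ μH[(d : ℝ)] := by
    -- Working with every δ above diam(t)^d covers sets of diameter 0, which need not fit a single
    -- coset of measure 0. Passing to the closure keeps the diameter and gives measurability.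
    refine le_hausdorffMeasure _ _ ε hε fun t ht => le_of_forall_gt_imp_ge_of_dense fun δ hδ => ?_
    rw [← Metric.ediam_closure t] at ht hδ
    obtain ⟨i, k, hk, hi⟩ := h (closure t) ht δ hδ
    calc ν.map f t ≤ ν.map f (closure t) := measure_mono subset_closure
      _ = ν (f ⁻¹' closure t) := map_apply hfc.measurable isClosed_closure.measurableSet
      _ ≤ ν {y | k⁻¹ * y ∈ V i} := measure_mono hk
      _ ≤ δ := (hVν i k).trans_le hi
  refine le_dimH_of_hausdorffMeasure_ne_zero fun h0 => ?_
  have h1 : ν.map f (Set.range f) = 0 := le_antisymm ((hle _).trans h0.le) bot_le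
  have h2 := le_map_apply (μ := ν) hfc.measurable.aemeasurable (Set.range f)
  rw [Set.preimage_range, h1, hν1] at h2
  exact one_ne_zero (le_antisymm h2 bot_le)

namespace FiltrationSeries

variable {G : Type*} [Group G] [TopologicalSpace G]

theorem isOpen_sub (S : FiltrationSeries G) (i : ℕ) : IsOpen (S.sub i : Set G) :=
  (S.term i).toOpenSubgroup.isOpen

variable (S : FiltrationSeries G)

theorem dist_le_of_mem {x y : G} {i : ℕ} (h : x⁻¹ * y ∈ S.sub i) :
    S.dist x y ≤ ((S.sub i).index : ℝ≥0∞)⁻¹ := by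
  by_cases hxy : x = y
  · simp [dist, hxy]
  · rw [dist, if_neg hxy]
    exact iInf₂_le i h

theorem tendsto_inv_index (hS : Tendsto (fun i => (S.sub i).index) atTop atTop) :
    Tendsto (fun i => ((S.sub i).index : ℝ≥0∞)⁻¹) atTop (𝓝 0) :=
  ENNReal.tendsto_inv_nat_nhds_zero.comp hS

variable [IsTopologicalGroup G] [CompactSpace G]

theorem le_dist_of_notMem {x y : G} {i : ℕ} (h : x⁻¹ * y ∉ S.sub (i + 1)) :
    ((S.sub i).index : ℝ≥0∞)⁻¹ ≤ S.dist x y := by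
  have hxy : x ≠ y := by
    rintro rfl
    exact h (by simp [one_mem])
  rw [dist, if_neg hxy]
  refine le_iInf₂ fun j hj => S.inv_index_antitone ?_
  by_contra! hlt
  exact h (S.antitone _ _ hlt hj)

/-- The cosets of S_i that meet H cover it, and each has diameter at most |G : S_i|⁻¹. -/
theorem hdim_le_of_frequently (hS : Tendsto (fun i => (S.sub i).index) atTop atTop)
    (H : Subgroup G) (d : NNReal)
    (h : ∃ᶠ i in atTop, ((S.sub i).relIndex H : ℝ) ≤ ((S.sub i).index : ℝ) ^ (d : ℝ)) :
    S.hdim (H : Set G) ≤ d := by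
  classical
  refine @dimH_le_of_frequently_cover G S.emetricSpace (H : Set G) d _ (S.tendsto_inv_index hS)
    (h.mono fun i hi => ?_)
  have hne : (S.sub i).relIndex H ≠ 0 := Subgroup.relIndex_ne_zero_of_isOpen (S.isOpen_sub i) H
  have hfin : Finite (H ⧸ (S.sub i).subgroupOf H) := Nat.finite_of_card_ne_zero hne
  have := Fintype.ofFinite (H ⧸ (S.sub i).subgroupOf H)
  let T : Finset (Set G) := (Finset.univ : Finset (H ⧸ (S.sub i).subgroupOf H)).image
    fun q => {y | ((q.out : H) : G)⁻¹ * y ∈ S.sub i}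
  refine ⟨T, ?_, ?_, ?_⟩
  · intro y hy
    have : ((Quotient.out (QuotientGroup.mk (s := (S.sub i).subgroupOf H) ⟨y, hy⟩) : H) : G)⁻¹ * y
        ∈ S.sub i := by
      have := QuotientGroup.eq.1 (QuotientGroup.out_eq'
        (QuotientGroup.mk (s := (S.sub i).subgroupOf H) ⟨y, hy⟩))
      simpa [Subgroup.mem_subgroupOf] using this
    simp only [Set.mem_iUnion]
    exact ⟨_, Finset.mem_image_of_mem _ (Finset.mem_univ _), this⟩
  · intro t ht
    obtain ⟨q, -, rfl⟩ := Finset.mem_image.1 ht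
    refine @Metric.ediam_le G _ S.emetricSpace.toPseudoEMetricSpace _ fun y hy z hz => S.dist_le_of_mem ?_
    have := (S.sub i).mul_mem ((S.sub i).inv_mem hy) hz
    simpa [mul_assoc] using this
  · have hcard : T.card ≤ (S.sub i).relIndex H :=
      Finset.card_image_le.trans (by
        rw [Finset.card_univ, ← Nat.card_eq_fintype_card]; exact le_rfl)
    have hpos : (0 : ℝ) < (S.sub i).index :=
      Nat.cast_pos.2 (Nat.pos_of_ne_zero (S.index_ne_zero i))
    have h1 : (T.card : ℝ≥0∞) ≤ ((S.sub i).index : ℝ≥0∞) ^ (d : ℝ) := by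
      have h2 : (T.card : ℝ) ≤ ((S.sub i).index : ℝ) ^ (d : ℝ) :=
        le_trans (by exact_mod_cast hcard) hi
      have h3 := ENNReal.ofReal_le_ofReal h2
      rwa [ENNReal.ofReal_natCast, ← ENNReal.ofReal_rpow_of_pos hpos, ENNReal.ofReal_natCast] at h3
    rw [ENNReal.inv_rpow]
    exact (mul_le_mul_left h1 _).trans (ENNReal.mul_inv_le_one _)

/-- Mass distribution for Haar measure on H. If S_{i+1} is the first term that separates points of
t, then t lies in one coset of S_i and diam(t) ≥ |G : S_i|⁻¹, while the trace on H of that coset has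
measure |H : H ∩ S_i|⁻¹ ≤ |G : S_i|^(-d). -/
theorem le_hdim_of_eventually (hS : Tendsto (fun i => (S.sub i).index) atTop atTop)
    (H : Subgroup G) (hH : IsClosed (H : Set G)) (d : NNReal) (hd : 0 < d)
    (h : ∀ᶠ i in atTop, ((S.sub i).index : ℝ) ^ (d : ℝ) ≤ ((S.sub i).relIndex H : ℝ)) :
    d ≤ S.hdim (H : Set G) := by
  have hHc : CompactSpace H := isCompact_iff_compactSpace.1 hH.isCompact
  obtain ⟨N, hN⟩ := eventually_atTop.1 h
  have hinv : ∀ i ≥ N, ((S.sub i).relIndex H : ℝ≥0∞)⁻¹ ≤ (((S.sub i).index : ℝ≥0∞)⁻¹) ^ (d : ℝ) := by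
    intro i hi
    have hpos : (0 : ℝ) < (S.sub i).index :=
      Nat.cast_pos.2 (Nat.pos_of_ne_zero (S.index_ne_zero i))
    rw [ENNReal.inv_rpow, ENNReal.inv_le_inv]
    have h3 := ENNReal.ofReal_le_ofReal (hN i hi)
    rwa [ENNReal.ofReal_natCast, ← ENNReal.ofReal_rpow_of_pos hpos, ENNReal.ofReal_natCast] at h3
  -- Diameters at most |G : S_N'|⁻¹ only involve levels i ≥ N, where the hypothesis holds.
  obtain ⟨N', hN'⟩ := eventually_atTop.1 (hS.eventually_gt_atTop ((S.sub N).index))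
  have hlarge : ∀ i, ((S.sub i).index : ℝ≥0∞)⁻¹ ≤ ((S.sub N').index : ℝ≥0∞)⁻¹ → N ≤ i := by
    intro i hi
    by_contra! hlt
    have h1 := ENNReal.inv_le_inv.1 hi
    have h2 : (S.sub N').index ≤ (S.sub i).index := by exact_mod_cast h1
    have h3 : (S.sub i).index ≤ (S.sub N).index := by
      exact_mod_cast ENNReal.inv_le_inv.1 (S.inv_index_antitone hlt.le)
    have h4 := hN' N' le_rfl
    omega
  have key := @le_dimH_range_of_preimage_subset_coset G S.emetricSpace H _ _ _ _ Subtype.val ?_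
    (fun i => (S.sub i).subgroupOf H) ?_ d ((S.sub N').index : ℝ≥0∞)⁻¹ (by simp) ?_
  · rwa [Subtype.range_coe] at key
  · intro k ε hε
    obtain ⟨i, hi⟩ := ((S.tendsto_inv_index hS).eventually_lt_const hε).exists
    have hop : IsOpen {k' : H | (k' : G)⁻¹ * (k : G) ∈ S.sub i} :=
      (S.isOpen_sub i).preimage (by fun_prop)
    filter_upwards [hop.mem_nhds (by simp [one_mem])] with k' hk'
    exact (S.dist_le_of_mem hk').trans_lt hi
  · intro i
    exact (S.isOpen_sub i).preimage continuous_subtype_val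
  · intro t ht δ hδ
    by_cases hex : ∃ a b : H, (a : G) ∈ t ∧ (b : G) ∈ t ∧ a ≠ b
    · obtain ⟨a, b, ha, hb, hab⟩ := hex
      have hsep : ∃ j, ∃ y : H, (y : G) ∈ t ∧ (a : G)⁻¹ * y ∉ S.sub j := by
        by_contra! hall
        have hmem : (a : G)⁻¹ * b ∈ ⨅ i, (S.term i).toSubgroup :=
          Subgroup.mem_iInf.2 fun j => hall j b hb
        rw [S.iInf_eq_bot, Subgroup.mem_bot, inv_mul_eq_one] at hmem
        exact hab (Subtype.ext hmem)
      classical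
      -- Since S_0 = G separates nothing, the first separating level is a successor.
      obtain ⟨i, hi⟩ : ∃ i, Nat.find hsep = i + 1 := by
        refine Nat.exists_eq_succ_of_ne_zero fun h0 => ?_
        obtain ⟨y, -, hy⟩ := Nat.find_spec hsep
        rw [h0] at hy
        refine hy ?_
        change _ ∈ (S.term 0).toSubgroup
        rw [S.term_zero]
        exact Subgroup.mem_top _
      obtain ⟨y, hyt, hy⟩ := Nat.find_spec hsep
      rw [hi] at hy
      have hdiam : ((S.sub i).index : ℝ≥0∞)⁻¹ ≤ @Metric.ediam G S.emetricSpace.toPseudoEMetricSpace t :=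
        (S.le_dist_of_notMem hy).trans
          (@Metric.edist_le_ediam_of_mem G t _ _ S.emetricSpace.toPseudoEMetricSpace ha hyt)
      refine ⟨i, a, fun z hz => ?_, ?_⟩
      · have := Nat.find_min hsep (m := i) (by omega)
        by_contra hzi
        exact this ⟨z, hz, hzi⟩
      · exact (hinv i (hlarge i (hdiam.trans ht))).trans
          ((ENNReal.rpow_le_rpow hdiam d.2).trans hδ.le)
    -- Here t contains at most one point of H; as d > 0, deep cosets have arbitrarily small measure.
    · push Not at hex
      have hδ0 : 0 < δ := bot_le.trans_lt hδ
      have hlim : Tendsto (fun i => (((S.sub i).index : ℝ≥0∞)⁻¹) ^ (d : ℝ)) atTop (𝓝 0) := by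
        have := (ENNReal.continuous_rpow_const (y := (d : ℝ))).tendsto 0 |>.comp
          (S.tendsto_inv_index hS)
        rwa [ENNReal.zero_rpow_of_pos (by exact_mod_cast hd)] at this
      obtain ⟨i, hiδ, hiN⟩ := ((hlim.eventually_lt_const hδ0).and (eventually_ge_atTop N)).exists
      by_cases hne : ∃ a : H, (a : G) ∈ t
      · obtain ⟨a, ha⟩ := hne
        refine ⟨i, a, fun y hy => ?_, (hinv i hiN).trans hiδ.le⟩
        rw [hex a y ha hy, inv_mul_cancel]
        exact one_mem _
      · exact ⟨i, 1, fun y hy => absurd ⟨y, hy⟩ hne, (hinv i hiN).trans hiδ.le⟩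

end FiltrationSeries

/-! ### Minimal closed normal subgroups with prescribed index growth -/

/-- In a pro-`p` group, below a closed normal subgroup `H` and above a smaller closed normal
subgroup `L` there is a closed normal subgroup of index `p` in `H`. -/
theorem IsProP.exists_isClosed_normal_relIndex_eq {p : ℕ} (hp : p.Prime) {G : Type*} [Group G]
    [TopologicalSpace G] [IsTopologicalGroup G] [CompactSpace G] [T2Space G]
    [TotallyDisconnectedSpace G] (hG : IsProP p G) {L H : Subgroup G} [L.Normal] [H.Normal]
    (hL : IsClosed (L : Set G)) (hH : IsClosed (H : Set G)) (hLH : L ≤ H) (hne : ¬ H ≤ L) :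
    ∃ K : Subgroup G, IsClosed (K : Set G) ∧ K.Normal ∧ L ≤ K ∧ K ≤ H ∧ K.relIndex H = p := by
  obtain ⟨h, hhH, hhL⟩ := SetLike.not_le_iff_exists.1 hne
  have hop : IsOpen ((fun y => h * y) ⁻¹' (L : Set G)ᶜ) :=
    hL.isOpen_compl.preimage (continuous_const_mul h)
  -- As hU misses L, the images of L and H in the finite p-group G/U still differ.
  obtain ⟨U, hU⟩ := ProfiniteGrp.exist_openNormalSubgroup_sub_open_nhds_of_one hop
    (by simpa using hhL)
  let π := QuotientGroup.mk' U.toSubgroup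
  have hπ : Function.Surjective π := QuotientGroup.mk'_surjective _
  have hUo : IsOpen (U.toSubgroup : Set G) := U.toOpenSubgroup.isOpen
  have hfin : Finite (G ⧸ U.toSubgroup) := Subgroup.quotient_finite_of_isOpen _ hUo
  have hLn : (L.map π).Normal := Subgroup.Normal.map inferInstance _ hπ
  have hHn : (H.map π).Normal := Subgroup.Normal.map inferInstance _ hπ
  have hlt : L.map π < H.map π := by
    refine lt_of_le_not_ge (Subgroup.map_mono hLH) fun hle => ?_
    obtain ⟨l, hl, hlh⟩ := hle (Subgroup.mem_map_of_mem π hhH)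
    have hu : h⁻¹ * l ∈ U.toSubgroup := QuotientGroup.eq.1 hlh.symm
    exact hU hu (by simpa using hl)
  obtain ⟨K, hKn, hLK, hKH, hK⟩ := (hG U).exists_normal_relIndex_eq hp hlt
  have hKo : IsOpen ((K.comap π : Subgroup G) : Set G) := by
    refine Subgroup.isOpen_mono (H₁ := U.toSubgroup) ?_ hUo
    exact (QuotientGroup.ker_mk' U.toSubgroup).ge.trans (MonoidHom.ker_le_comap π K)
  refine ⟨K.comap π ⊓ H, ?_, inferInstance, le_inf (Subgroup.map_le_iff_le_comap.1 hLK) hLH,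
    inf_le_right, ?_⟩
  · exact (Subgroup.isClosed_of_isOpen _ hKo).inter hH
  · rw [Subgroup.inf_relIndex_right, Subgroup.relIndex_comap, hK]

namespace FiltrationSeries

variable {G : Type*} [Group G] [TopologicalSpace G] [IsTopologicalGroup G] [CompactSpace G]
  (S : FiltrationSeries G)

theorem relIndex_ne_zero (i : ℕ) (H : Subgroup G) : (S.sub i).relIndex H ≠ 0 :=
  Subgroup.relIndex_ne_zero_of_isOpen (S.isOpen_sub i) H

/-- Otherwise the increasing indices stabilise at some N; then S_N ∩ H lies in every S_i, so it is
trivial and H is finite. -/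
theorem tendsto_relIndex (H : Subgroup G) [Infinite H] :
    Tendsto (fun i => (S.sub i).relIndex H) atTop atTop := by
  have hmono : Monotone fun i => (S.sub i).relIndex H := fun i j hij =>
    Subgroup.relIndex_le_of_le_left (S.antitone i j hij) (S.relIndex_ne_zero j H)
  refine (tendsto_atTop_of_monotone hmono).resolve_right ?_
  rintro ⟨l, hl⟩
  rw [nhds_discrete, tendsto_pure] at hl
  obtain ⟨N, hN⟩ := eventually_atTop.1 hl
  have hle : ∀ i, S.sub N ⊓ H ≤ S.sub i := by
    intro i
    refine le_trans ?_ (S.antitone i (max i N) (le_max_left _ _))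
    change _ ≤ S.sub (max i N)
    have h1 := Subgroup.relIndex_inf_mul_relIndex (S.sub (max i N)) (S.sub N) H
    have h2 : S.sub (max i N) ≤ S.sub N := S.antitone N (max i N) (le_max_right _ _)
    rw [inf_eq_left.2 h2,
      hN _ (le_max_right _ _), hN N le_rfl] at h1
    have hl0 : l ≠ 0 := hN N le_rfl ▸ S.relIndex_ne_zero N H
    exact Subgroup.relIndex_eq_one.1 ((Nat.mul_eq_right hl0).1 h1)
  have hbot : S.sub N ⊓ H = ⊥ := by
    rw [eq_bot_iff, ← S.iInf_eq_bot]
    exact le_iInf hle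
  apply S.relIndex_ne_zero N H
  rw [← Subgroup.inf_relIndex_right, hbot, Subgroup.relIndex_bot_left, Nat.card_eq_zero_of_infinite]

theorem tendsto_index [Infinite G] : Tendsto (fun i => (S.sub i).index) atTop atTop := by
  have : Infinite (⊤ : Subgroup G) := Subgroup.topEquiv.toEquiv.infinite_iff.2 inferInstance
  simpa using S.tendsto_relIndex ⊤

/-- If closed normal closures of finite subsets of `Z` cannot have index at least `c i` over `S i`
for all `i`, then `Z` has a closed subgroup, normal in `G`, whose indices are bounded below by
`c i`, and infinitely often bounded above by `p * c i`. -/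
theorem exists_isClosed_normal_frequently_relIndex_lt {p : ℕ} (hp : p.Prime) [T2Space G]
    [TotallyDisconnectedSpace G] (hG : IsProP p G) (Z : Subgroup G) [Z.Normal]
    (hZ : IsClosed (Z : Set G)) (c : ℕ → ℝ) (hcZ : ∀ i, c i ≤ (S.sub i).relIndex Z)
    (hfg : ∀ F : Finset G, (F : Set G) ⊆ Z → ∃ i,
      ((S.sub i).relIndex (Subgroup.normalClosure (F : Set G)).topologicalClosure : ℝ) < c i) :
    ∃ H : Subgroup G, IsClosed (H : Set G) ∧ H.Normal ∧ (∀ i, c i ≤ (S.sub i).relIndex H) ∧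
      ∃ᶠ i in atTop, ((S.sub i).relIndex H : ℝ) < p * c i := by
  classical
  obtain ⟨H, ⟨hHcl, hHn, hHZ, hcH⟩, hmin⟩ :=
    exists_minimal_isClosed_normal_le_relIndex S.sub S.isOpen_sub c Z hZ hcZ
  refine ⟨H, hHcl, hHn, hcH, fun hev => ?_⟩
  obtain ⟨N, hN⟩ := eventually_atTop.1 hev
  simp only [not_lt] at hN
  have hfin : Finite (H ⧸ (S.sub N).subgroupOf H) :=
    Nat.finite_of_card_ne_zero (S.relIndex_ne_zero N H)
  have := Fintype.ofFinite (H ⧸ (S.sub N).subgroupOf H)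
  let F : Finset G := (Finset.univ : Finset (H ⧸ (S.sub N).subgroupOf H)).image
    fun q => ((q.out : H) : G)
  have hFH : (F : Set G) ⊆ H := by
    intro f hf
    obtain ⟨q, -, rfl⟩ := Finset.mem_image.1 (Finset.mem_coe.1 hf)
    exact q.out.2
  let L : Subgroup G := (Subgroup.normalClosure (F : Set G)).topologicalClosure
  have hLn : L.Normal := Subgroup.is_normal_topologicalClosure _
  have hLcl : IsClosed (L : Set G) := Subgroup.isClosed_topologicalClosure _
  have hLH : L ≤ H :=
    Subgroup.topologicalClosure_minimal _ (Subgroup.normalClosure_le_normal hFH) hHcl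
  have hFL : (F : Set G) ⊆ L :=
    Subgroup.subset_normalClosure.trans (Subgroup.le_topologicalClosure _)
  have hHL : H ≤ L ⊔ S.sub N := by
    intro y hy
    have hq := QuotientGroup.eq.1 (QuotientGroup.out_eq'
      (QuotientGroup.mk (s := (S.sub N).subgroupOf H) ⟨y, hy⟩))
    set q := Quotient.out (QuotientGroup.mk (s := (S.sub N).subgroupOf H) ⟨y, hy⟩) with hqdef
    have hqF : (q : G) ∈ F := Finset.mem_image.2 ⟨_, Finset.mem_univ _, rfl⟩
    have := (L ⊔ S.sub N).mul_mem (Subgroup.mem_sup_left (hFL hqF))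
      (Subgroup.mem_sup_right (S := L) (Subgroup.mem_subgroupOf.1 hq))
    simpa using this
  have hne : ¬ H ≤ L := by
    intro hle
    obtain ⟨i, hi⟩ := hfg F (hFH.trans hHZ)
    have hLH' : (Subgroup.normalClosure (F : Set G)).topologicalClosure = H := le_antisymm hLH hle
    rw [hLH'] at hi
    exact hi.not_ge (hcH i)
  obtain ⟨K, hKcl, hKn, hLK, hKH, hK⟩ :=
    hG.exists_isClosed_normal_relIndex_eq hp hLcl hHcl hLH hne
  -- For i ≤ N, K contains representatives of H modulo S_N, so KS_i = HS_i. For i ≥ N, the index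
  -- drops by at most |H : K| = p, which the assumed bound p·c_i absorbs.
  have hcK : ∀ i, c i ≤ (S.sub i).relIndex K := by
    intro i
    rcases le_total i N with hi | hi
    · refine (hcH i).trans ?_
      rw [← Subgroup.relIndex_sup_right K (S.sub i)]
      have hle : H ≤ K ⊔ S.sub i := hHL.trans (sup_le_sup hLK (S.antitone i N hi))
      exact_mod_cast Subgroup.relIndex_le_of_le_right hle (S.relIndex_ne_zero i _)
    · have h1 := Subgroup.relIndex_inf_mul_relIndex (S.sub i) K H
      rw [inf_eq_left.2 hKH, hK] at h1
      have h2 : (S.sub i).relIndex H ≤ (S.sub i).relIndex K * p := by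
        rw [h1]
        refine Subgroup.relIndex_le_of_le_left inf_le_left ?_
        rw [← h1]
        exact mul_ne_zero (S.relIndex_ne_zero i K) hp.ne_zero
      have h3 : (p : ℝ) * c i ≤ p * (S.sub i).relIndex K := by
        rw [mul_comm (p : ℝ) ((S.sub i).relIndex K : ℝ)]
        exact (hN i hi).trans (by exact_mod_cast h2)
      exact le_of_mul_le_mul_left h3 (by exact_mod_cast hp.pos)
  have hHK : H ≤ K := hmin ⟨hKcl, hKn, hKH.trans hHZ, hcK⟩ hKH
  rw [Subgroup.relIndex_eq_one.2 hHK] at hK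
  exact hp.one_lt.ne hK

end FiltrationSeries

/-! ### Logarithmic densities and the dimension of H -/

namespace FiltrationSeries

variable {G : Type*} [Group G] [TopologicalSpace G] (S : FiltrationSeries G)

theorem logDensity_eq {p : ℕ} (hp : p.Prime) (H : Subgroup G) (i : ℕ) :
    logDensity p S H i = Real.log ((S.sub i).relIndex H) / Real.log ((S.sub i).index) := by
  have : Real.log p ≠ 0 := (Real.log_pos (by exact_mod_cast hp.one_lt)).ne'
  rw [logDensity, Subgroup.relIndex_sup_right, Real.logb, Real.logb, div_div_div_cancel_right₀ this]

theorem logDensity_nonneg {p : ℕ} (hp : p.Prime) (H : Subgroup G) (i : ℕ) :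
    0 ≤ logDensity p S H i := by
  rw [S.logDensity_eq hp]
  exact div_nonneg (Real.log_natCast_nonneg _) (Real.log_natCast_nonneg _)

variable [IsTopologicalGroup G] [CompactSpace G]

theorem logDensity_le_one {p : ℕ} (hp : p.Prime) (H : Subgroup G) (i : ℕ) :
    logDensity p S H i ≤ 1 := by
  rw [S.logDensity_eq hp]
  refine div_le_one_of_le₀ (Real.log_le_log ?_ ?_) (Real.log_natCast_nonneg _)
  · exact_mod_cast Nat.pos_of_ne_zero (S.relIndex_ne_zero i H)
  · exact_mod_cast Nat.le_of_dvd (Nat.pos_of_ne_zero (S.index_ne_zero i))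
      (Subgroup.relIndex_dvd_index_of_normal (S.sub i) H)

/-- A closed subgroup whose indices over the filtration are at least the `θ`-th powers of those of
`Z`, and infinitely often less than a constant multiple of them, has dimension `θ` times the
limit of the densities of `Z`. -/
theorem hdim_eq_of_frequently [Infinite G] {p : ℕ} (hp : p.Prime) {Z H : Subgroup G}
    (hH : IsClosed (H : Set G)) {θ x : ℝ}
    (hx : Tendsto (fun i => logDensity p S Z i) atTop (𝓝 x))
    (hlow : ∀ i, ((S.sub i).relIndex Z : ℝ) ^ θ ≤ (S.sub i).relIndex H)
    (hup : ∃ᶠ i in atTop, ((S.sub i).relIndex H : ℝ) < p * ((S.sub i).relIndex Z : ℝ) ^ θ) :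
    S.hdim (H : Set G) = ENNReal.ofReal (θ * x) := by
  have hg : Tendsto (fun i => Real.log ((S.sub i).index)) atTop atTop :=
    Real.tendsto_log_atTop.comp (tendsto_natCast_atTop_atTop.comp S.tendsto_index)
  have hgpos : ∀ i, (0 : ℝ) < (S.sub i).index := fun i =>
    Nat.cast_pos.2 (Nat.pos_of_ne_zero (S.index_ne_zero i))
  have hzpos : ∀ i, (0 : ℝ) < (S.sub i).relIndex Z := fun i =>
    Nat.cast_pos.2 (Nat.pos_of_ne_zero (S.relIndex_ne_zero i Z))
  have hppos : (0 : ℝ) < p := by exact_mod_cast hp.pos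
  have hlim : Tendsto (fun i => θ * logDensity p S Z i) atTop (𝓝 (θ * x)) := hx.const_mul θ
  refine le_antisymm ?_ ?_
  · refine le_of_forall_gt_imp_ge_of_dense fun b hb => ?_
    obtain ⟨d, hd, hdb⟩ := ENNReal.lt_iff_exists_nnreal_btwn.1 hb
    refine le_trans (S.hdim_le_of_frequently S.tendsto_index H d ?_) hdb.le
    have hd' : θ * x < d := by
      refine lt_of_not_ge fun h => hd.not_ge ?_
      rw [← ENNReal.ofReal_coe_nnreal]
      exact ENNReal.ofReal_le_ofReal h
    -- After taking logarithms, the constant factor p contributes only this null sequence.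
    have h0 : Tendsto (fun i => Real.log p / Real.log ((S.sub i).index)) atTop (𝓝 0) :=
      tendsto_const_nhds.div_atTop hg
    have hsum := h0.add hlim
    rw [zero_add] at hsum
    refine (hup.and_eventually ((hsum.eventually_lt_const hd').and (hg.eventually_gt_atTop 0))).mono
      fun i hi => ?_
    obtain ⟨hi1, hi2, hi3⟩ := hi
    refine hi1.le.trans ?_
    rw [← Real.log_le_log_iff (by have := hzpos i; positivity) (Real.rpow_pos_of_pos (hgpos i) _),
      Real.log_mul hppos.ne' (Real.rpow_pos_of_pos (hzpos i) _).ne', Real.log_rpow (hzpos i),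
      Real.log_rpow (hgpos i), ← div_le_iff₀ hi3, add_div, mul_div_assoc, ← S.logDensity_eq hp]
    exact hi2.le
  · refine ENNReal.le_of_forall_nnreal_lt fun s hs => ?_
    rcases eq_or_ne s 0 with rfl | hs0
    · simp
    refine S.le_hdim_of_eventually S.tendsto_index H hH s (pos_iff_ne_zero.2 hs0) ?_
    have hs' : (s : ℝ) < θ * x := by
      refine lt_of_not_ge fun h => hs.not_ge ?_
      rw [← ENNReal.ofReal_coe_nnreal]
      exact ENNReal.ofReal_le_ofReal h
    filter_upwards [hlim.eventually_const_lt hs', hg.eventually_gt_atTop 0] with i hi2 hi3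
    refine le_trans ?_ (hlow i)
    rw [← Real.log_le_log_iff (Real.rpow_pos_of_pos (hgpos i) _)
      (Real.rpow_pos_of_pos (hzpos i) _), Real.log_rpow (hzpos i), Real.log_rpow (hgpos i),
      ← le_div_iff₀ hi3, mul_div_assoc, ← S.logDensity_eq hp]
    exact hi2.le

end FiltrationSeries

/-! ### The growth hypothesis and the conclusion -/

/-- If a sequence of quotients `a i / log_p m i` has lower limit zero and `m i ≤ z i → ∞`, then no
positive power of `z i` is bounded by a power of `p ^ a i`. -/
theorem exists_pow_lt_rpow_of_liminf_eq_zero {p : ℕ} (hp : p.Prime) {a m z : ℕ → ℕ}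
    (hlim : liminf (fun i => (a i : ℝ≥0∞) / ENNReal.ofReal (Real.logb p (m i))) atTop = 0)
    (hm0 : ∀ i, m i ≠ 0) (hmz : ∀ i, m i ≤ z i) (hz : Tendsto z atTop atTop) {θ : ℝ} (hθ : 0 < θ)
    (C : ℕ) : ∃ i, ((p ^ (a i * C) : ℕ) : ℝ) < (z i : ℝ) ^ θ := by
  by_contra! hall
  have hp1 : (1 : ℝ) < p := by exact_mod_cast hp.one_lt
  have hlog : ∀ i, θ * Real.logb p (z i) ≤ a i * C := by
    intro i
    have hz0 : (0 : ℝ) < z i :=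
      Nat.cast_pos.2 ((Nat.pos_of_ne_zero (hm0 i)).trans_le (hmz i))
    have h := Real.logb_le_logb_of_le hp1 (Real.rpow_pos_of_pos hz0 θ) (hall i)
    rw [Real.logb_rpow_eq_mul_logb_of_pos hz0, Nat.cast_pow, Real.logb_pow,
      Real.logb_self_eq_one hp1, mul_one] at h
    exact_mod_cast h
  -- If z_i^θ ≤ p^(a_i C) for all i, the quotients stay above θ/C > 0. Once z_i > 1, this inequality
  -- also forces a_i and C to be positive.
  have hev : ∀ᶠ i in atTop, ENNReal.ofReal (θ / C) ≤
      (a i : ℝ≥0∞) / ENNReal.ofReal (Real.logb p (m i)) := by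
    filter_upwards [hz.eventually_gt_atTop 1] with i hi
    have hzpos : 0 < Real.logb p (z i) := Real.logb_pos hp1 (by exact_mod_cast hi)
    have haC : 0 < (a i : ℝ) * C := (mul_pos hθ hzpos).trans_le (hlog i)
    have hC : (0 : ℝ) < C := pos_of_mul_pos_right haC (Nat.cast_nonneg _)
    have ha : (0 : ℝ) < a i := pos_of_mul_pos_left haC hC.le
    have hml : Real.logb p (m i) ≤ a i * C / θ := by
      rw [le_div_iff₀ hθ, mul_comm]
      refine le_trans (mul_le_mul_of_nonneg_left ?_ hθ.le) (hlog i)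
      exact Real.logb_le_logb_of_le hp1 (Nat.cast_pos.2 (Nat.pos_of_ne_zero (hm0 i)))
        (by exact_mod_cast hmz i)
    calc ENNReal.ofReal (θ / C) = (a i : ℝ≥0∞) / ENNReal.ofReal (a i * C / θ) := by
          rw [← ENNReal.ofReal_natCast (a i), ← ENNReal.ofReal_div_of_pos (div_pos haC hθ)]
          congr 1
          field_simp
      _ ≤ (a i : ℝ≥0∞) / ENNReal.ofReal (Real.logb p (m i)) :=
          ENNReal.div_le_div_left (ENNReal.ofReal_le_ofReal hml) _
  have hC : (0 : ℝ) < C := by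
    obtain ⟨i, hi⟩ := (hz.eventually_gt_atTop 1).exists
    have hzpos : 0 < Real.logb p (z i) := Real.logb_pos hp1 (by exact_mod_cast hi)
    exact pos_of_mul_pos_right ((mul_pos hθ hzpos).trans_le (hlog i)) (Nat.cast_nonneg _)
  have h := le_liminf_of_le (by isBoundedDefault) hev
  rw [hlim, nonpos_iff_eq_zero, ENNReal.ofReal_eq_zero] at h
  exact h.not_gt (div_pos hθ hC)

theorem proposition2p4 (p : ℕ) (hp : p.Prime)
    (G : Type*) [Group G] [TopologicalSpace G] [IsTopologicalGroup G] [CompactSpace G]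
    [T2Space G] [TotallyDisconnectedSpace G] (hG : IsProP p G) [SecondCountableTopology G]
    (Z : Subgroup G) [Z.Normal] (hZclosed : IsClosed (Z : Set G)) (hZinf : Infinite Z)
    (hZcomm : IsMulCommutative Z)
    (hproc : IsProcyclic (G ⧸ Subgroup.centralizer (Z : Set G)))
    (S : FiltrationSeries G)
    (e : ℕ → ℕ) (he : ∀ i, Monoid.exponent (Z ⧸ (S.sub i).subgroupOf Z) = p ^ e i)
    (n : ℕ → ℕ) (hn : ∀ i, 0 < n i)
    (M : ℕ → Subgroup G) (hMclosed : ∀ i, IsClosed (M i : Set G))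
    -- Mathlib's `lowerCentralSeries` starts at index `0`, so this term is `γ_{n i + 1}(G)`.
    (hγ : ∀ i, (⊤ : Subgroup G).lowerCentralSeries (n i) ⊓ Z ≤ S.sub i ⊓ Z)
    (hM : ∀ i, S.sub i ⊓ Z ≤ M i)
    -- `(M i).relIndex Z` is the index `|Z : M i ∩ Z|`; the quotients are taken in `[0, ∞]`.
    (hlim : liminf (fun i => ((e i * n i : ℕ) : ℝ≥0∞) /
      ENNReal.ofReal (Real.logb p ((M i).relIndex Z))) atTop = 0)
    (ξ : ℝ≥0∞) (hξ : S.hdim (Z : Set G) = ξ)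
    (hstrong : S.HasStrongHausdorffDimension p Z) :
    Set.Icc 0 ξ ⊆ S.normalHausdorffSpectrum := by
  rintro η ⟨-, hηξ⟩
  -- The trivial subgroup has dimension 0; otherwise ξ > 0 and θ = η/ξ makes sense.
  rcases eq_or_ne η 0 with rfl | hη0
  · exact ⟨⊥, by simp, inferInstance, by simp [FiltrationSeries.hdim]⟩
  have hGinf : Infinite G := Infinite.of_injective (Subtype.val : Z → G) Subtype.val_injective
  have hlogZ : Tendsto (fun i => S.logDensity p Z i) atTop (𝓝 ξ.toReal) ∧ ξ ≠ ⊤ := by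
    have hst : Tendsto (fun i => ENNReal.ofReal (S.logDensity p Z i)) atTop (𝓝 ξ) := by
      rw [← hξ]
      exact hstrong
    have hξ1 : ξ ≤ 1 := le_of_tendsto' hst fun i => by
      rw [← ENNReal.ofReal_one]
      exact ENNReal.ofReal_le_ofReal (S.logDensity_le_one hp Z i)
    have hξt : ξ ≠ ⊤ := ne_top_of_le_ne_top ENNReal.one_ne_top hξ1
    refine ⟨((ENNReal.tendsto_toReal hξt).comp hst).congr fun i => ?_, hξt⟩
    exact ENNReal.toReal_ofReal (S.logDensity_nonneg hp Z i)
  obtain ⟨hlogZ, hξt⟩ := hlogZ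
  have hηt : η ≠ ⊤ := ne_top_of_le_ne_top hξt hηξ
  have hy0 : 0 < η.toReal := ENNReal.toReal_pos hη0 hηt
  have hyx : η.toReal ≤ ξ.toReal := ENNReal.toReal_mono hξt hηξ
  have hx0 : 0 < ξ.toReal := hy0.trans_le hyx
  set θ : ℝ := η.toReal / ξ.toReal with hθdef
  have hθ0 : 0 < θ := div_pos hy0 hx0
  have hθ1 : θ ≤ 1 := div_le_one_of_le₀ hyx hx0.le
  have hexp : ∀ i, ∀ z ∈ Z, z ^ p ^ e i ∈ S.sub i := by
    intro i z hz
    have h := Monoid.pow_exponent_eq_one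
      (QuotientGroup.mk (s := (S.sub i).subgroupOf Z) (⟨z, hz⟩ : Z))
    rw [he i, ← QuotientGroup.mk_pow, QuotientGroup.eq_one_iff] at h
    exact h
  -- M_i enters only here: |Z : M_i ∩ Z| bounds |Z : S_i ∩ Z| from below.
  have hMne : ∀ i, (M i).relIndex Z ≠ 0 ∧ (M i).relIndex Z ≤ (S.sub i).relIndex Z := by
    intro i
    have h := Subgroup.relIndex_dvd_of_le_left Z (hM i)
    rw [Subgroup.inf_relIndex_right] at h
    exact ⟨ne_zero_of_dvd_ne_zero (S.relIndex_ne_zero i Z) h,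
      Nat.le_of_dvd (Nat.pos_of_ne_zero (S.relIndex_ne_zero i Z)) h⟩
  have hle : ∀ i, ((S.sub i).relIndex Z : ℝ) ^ θ ≤ (S.sub i).relIndex Z := by
    intro i
    refine (Real.rpow_le_rpow_of_exponent_le ?_ hθ1).trans_eq (Real.rpow_one _)
    exact_mod_cast Nat.one_le_iff_ne_zero.2 (S.relIndex_ne_zero i Z)
  have hfg : ∀ F : Finset G, (F : Set G) ⊆ Z → ∃ i,
      ((S.sub i).relIndex (Subgroup.normalClosure (F : Set G)).topologicalClosure : ℝ) <
        ((S.sub i).relIndex Z : ℝ) ^ θ := by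
    intro F hF
    obtain ⟨i, hi⟩ := exists_pow_lt_rpow_of_liminf_eq_zero hp hlim (fun i => (hMne i).1)
      (fun i => (hMne i).2) (S.tendsto_relIndex Z) hθ0 F.card
    refine ⟨i, lt_of_le_of_lt ?_ hi⟩
    have h := relIndex_topologicalClosure_normalClosure_le (S.isOpen_sub i) hproc
      (Nat.pow_pos hp.pos) (hexp i) (hγ i) (hn i) F hF
    rw [← pow_mul, ← mul_assoc] at h
    exact_mod_cast h
  obtain ⟨H, hHcl, hHn, hlow, hup⟩ := S.exists_isClosed_normal_frequently_relIndex_lt hp hG Z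
    hZclosed (fun i => ((S.sub i).relIndex Z : ℝ) ^ θ) hle hfg
  refine ⟨H, hHcl, hHn, ?_⟩
  rw [S.hdim_eq_of_frequently hp hHcl hlogZ hlow hup, hθdef, div_mul_cancel₀ _ hx0.ne',
    ENNReal.ofReal_toReal hηt]
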